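/- **Intervention-assisted policy gradient theorem.** Consider a queueing-network Markov decision process with state space $\mathcal S=\mathbb N^{\iota}\times\mathcal Y$, where $\iota$ (the set of queues) and $\mathcal Y$ (the set of joint link states) are finite; a state is $s=(q,y)$ with $q$ the vector of queue backlogs. Each state $s$ has a finite set $\mathcal A(s)$ of valid actions, each transition distribution $P(\cdot\mid s,a)$ with $a\in\mathcal A(s)$ has finite support, $c:\mathcal S\to\mathbb R$ is a cost function (for delay minimization $c(q,y)=\sum_i q_i$), and $\rho_0$ is an initial state distribution. A policy $\pi$ assigns to each $s$ a distribution $\pi(\cdot\mid s)$ on $\mathcal A(s)$. It is *strongly stable* if $\limsup_{T\to\infty}\frac1T\sum_{t=0}^{T-1}\mathbb E_\pi[q_{i,t}\mid s_0]<\infty$ for every queue $i$ and every initial state $s_0$. Its average cost is $\eta(\pi)=\lim_{T\to\infty}\frac1T\sum_{t=0}^{T-1}\mathbb E_\pi[c(s_t)]$ with $s_0\sim\rho_0$, and its state-action value function is $$Q^\pi(s,a)=\sum_{t=0}^\infty\bigl(\mathbb E_\pi[c(s_t)\mid s_0=s,a_0=a]-\eta(\pi)\bigr).$$ Let $\mathcal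 S_\theta\subset\mathcal S$ be a finite learning region (the same for all parameters), $I(s)=0$ for $s\in\mathcal S_\theta$ and $I(s)=1$ otherwise. Let $\pi_0$ be a policy, let $\pi_\theta$ $(\theta\in\mathbb R^p)$ be a family of actor policies, and let $\pi_I(\cdot\mid s)=I(s)\,\pi_0(\cdot\mid s)+(1-I(s))\,\pi_\theta(\cdot\mid s)$ be the intervention-assisted policy with parameter $\theta$. Fix $\theta$ and suppose that * $\theta'\mapsto\pi_{\theta'}(a\mid s)$ is differentiable at $\theta$ for all $s\in\mathcal S_\theta$, $a\in\mathcal A(s)$; * for all parameters in a neighbourhood of $\theta$, the intervention-assisted policy is strongly stable, the state Markov chain it induces has at most one stationary distribution, and its average cost is well defined (each $\mathbb E[c(s_t)]$ converges absolutely and the limit exists in $\mathbb R$); * the series defining $Q^{\pi_I}(s,a)$ at the parameter $\theta$ converges for all $s\in\mathcal S_\theta$, $a\in\mathcal A(s)$. Then the state Markov chain under $\pi_I$ has a stationary distribution $d(\pi_I)$, the map $\theta\mapsto\eta(\pi_I)$ is differentiable at $\theta$, and $$\nabla_\theta\,\eta(\pi_I)=\mathop{\mathbb E}_{s\sim d(\pi_I),\;a\sim\pi_I(\cdot\mid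 s)}\bigl[(1-I(s))\,Q^{\pi_I}(s,a)\,\nabla_\theta\log\pi_\theta(a\mid s)\bigr].$$ In particular, states where an intervention occurs contribute nothing directly: $$\nabla_\theta\,\eta(\pi_I)=\sum_{s\in\mathcal S_\theta}d(\pi_I)(s)\sum_{a\in\mathcal A(s)}\pi_\theta(a\mid s)\,Q^{\pi_I}(s,a)\,\nabla_\theta\log\pi_\theta(a\mid s),$$ where actions with $\pi_\theta(a\mid s)=0$ contribute zero. -/

import Mathlib

open Filter Topology
open scoped ENNReal

noncomputable section

namespace QueueControl

/-- Expectation of a vector-valued function under a discrete distribution. -/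
def expect {X F : Type*} [AddCommMonoid F] [Module ℝ F] [TopologicalSpace F]
    (μ : PMF X) (f : X → F) : F :=
  ∑' x, (μ x).toReal • f x

/-- Network states `(q, y)`: a vector `q` of (unbounded) queue backlogs indexed by the finite set
`ι` of queues, and a joint link state `y` from a finite set `Y`. -/
abbrev NetState (ι Y : Type*) := (ι → ℕ) × Y

/-- A queueing-network Markov decision process on `NetState ι Y` with actions in `A`.  Each state
has a finite set of valid actions and, since arrivals and link states have finite discrete
distributions, each valid action leads to finitely many states.  The cost function is arbitrary;
for delay minimization it is the total backlog `fun s => ∑ i, (s.1 i : ℝ)`. -/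
structure NetworkMDP (ι Y A : Type*) where
  /-- the set `𝒜(s)` of valid actions -/
  valid : NetState ι Y → Finset A
  /-- the transition distribution `P(· | s, a)` -/
  trans : NetState ι Y → A → PMF (NetState ι Y)
  trans_finite : ∀ s, ∀ a ∈ valid s, (trans s a).support.Finite
  /-- the cost `c(s)` -/
  cost : NetState ι Y → ℝ
  /-- the initial state distribution -/
  init : PMF (NetState ι Y)

variable {ι Y A : Type*}

/-- A stationary Markov policy: `π(· | s)` is a distribution over the valid actions in `s`. -/
structure Policy (M : NetworkMDP ι Y A) where
  act : NetState ι Y → PMF A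
  support_subset : ∀ s, (act s).support ⊆ (M.valid s : Set A)

/-- One-step state-transition distribution `P_π(· | s)`. -/
def step (M : NetworkMDP ι Y A) (π : Policy M) (s : NetState ι Y) : PMF (NetState ι Y) :=
  (π.act s).bind (M.trans s)

/-- Law of the state `s_t` under the policy `π` when `s_0 ∼ ρ`. -/
def stateLaw (M : NetworkMDP ι Y A) (π : Policy M) (ρ : PMF (NetState ι Y)) :
    ℕ → PMF (NetState ι Y)
  | 0 => ρ
  | t + 1 => (stateLaw M π ρ t).bind (step M π)

/-- Law of the state `s_t` given `s_0 = s` and `a_0 = a`, later actions being chosen by `π`. -/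
def stateLawFrom (M : NetworkMDP ι Y A) (π : Policy M) (s : NetState ι Y) (a : A) :
    ℕ → PMF (NetState ι Y)
  | 0 => PMF.pure s
  | t + 1 => stateLaw M π (M.trans s a) t

/-- Strong stability: from every initial state, and for every queue `i`,
`limsup_T (1/T) ∑_{t<T} E_π[q_{i,t}] < ∞`. -/
def IsStronglyStable (M : NetworkMDP ι Y A) (π : Policy M) : Prop :=
  ∀ (s₀ : NetState ι Y) (i : ι),
    limsup (fun T : ℕ =>
      (∑ t ∈ Finset.range T, ∑' s, stateLaw M π (PMF.pure s₀) t s * (s.1 i : ℝ≥0∞)) / (T : ℝ≥0∞))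
      atTop < ⊤

/-- `d` is a steady-state distribution of the state Markov chain induced by `π`. -/
def IsSteadyState (M : NetworkMDP ι Y A) (π : Policy M) (d : PMF (NetState ι Y)) : Prop :=
  d.bind (step M π) = d

/-- `η` is the average cost of `π`: `η = lim_T (1/T) ∑_{t<T} E_π[c(s_t)]` with `s_0` drawn from the
initial distribution, the expectations and the limit being required to exist. -/
def IsAverageCost (M : NetworkMDP ι Y A) (π : Policy M) (η : ℝ) : Prop :=
  (∀ t, Summable fun s => (stateLaw M π M.init t s).toReal * M.cost s) ∧
  Tendsto (fun T : ℕ => (∑ t ∈ Finset.range T, expect (stateLaw M π M.init t) M.cost) / (T : ℝ))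
    atTop (𝓝 η)

/-- `v` is the state-action value of `π` at `(s, a)`, relative to the average cost `η`:
`v = ∑_{t≥0} (E_π[c(s_t) | s_0 = s, a_0 = a] - η)`, the series being required to converge. -/
def IsActionValue (M : NetworkMDP ι Y A) (π : Policy M) (η : ℝ) (s : NetState ι Y) (a : A)
    (v : ℝ) : Prop :=
  Tendsto (fun T : ℕ => ∑ t ∈ Finset.range T, (expect (stateLawFrom M π s a t) M.cost - η))
    atTop (𝓝 v)

open Classical in
/-- The intervention indicator `I(s)` for the learning region `L`: `0` on `L`, `1` off `L`. -/
def intervention (L : Finset (NetState ι Y)) (s : NetState ι Y) : ℝ :=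
  if s ∈ L then 0 else 1

open Classical in
/-- The intervention-assisted policy: actor `π` on the learning region, `π₀` elsewhere. -/
def assisted {M : NetworkMDP ι Y A} (L : Finset (NetState ι Y)) (π₀ π : Policy M) : Policy M where
  act s := if s ∈ L then π.act s else π₀.act s
  support_subset s := by
    split_ifs
    · exact π.support_subset s
    · exact π₀.support_subset s

/-- `π_I(a|s) = I(s) π₀(a|s) + (1 - I(s)) π(a|s)`. -/
theorem assisted_apply {M : NetworkMDP ι Y A} (L : Finset (NetState ι Y)) (π₀ π : Policy M)
    (s : NetState ι Y) (a : A) :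
    ((assisted L π₀ π).act s a).toReal =
      intervention L s * (π₀.act s a).toReal + (1 - intervention L s) * (π.act s a).toReal := by
  by_cases h : s ∈ L <;> simp [assisted, intervention, h]

end QueueControl

end

/-! Everything rests on an exact performance difference formula (`averageCost_sub`): if π' and π
differ only on the finite set L, then η' - η is the sum over s in L of d'(s) times ∑ₐ (π'(a|s) -
π(a|s)) Q(s,a), with Q belonging to the base policy π and d' to the perturbed policy π'. It comes
from Duhamel's formula for the t-step kernels, averaged in the Cesàro sense: the correction terms
form a convolution of visit probabilities with a convergent series whose sum is the Q-term.

At π' = π the Q-term vanishes, so differentiating the product needs no derivative of d', only its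
continuity at θ (`hasFDerivAt_mul_of_eq_zero`). The log-derivative trick then gives the stated
gradient.

Continuity of d' is the delicate point, since stability is not assumed uniform in the parameter.
Tightness is obtained instead from `exists_summable_dominating`: off L all kernels coincide, so each
perturbed stationary law there either is a bounded combination of finitely many fixed expected-visit
measures or equals d. Ultralimits of tight stationary laws are stationary, and uniqueness identifies
them. -/

namespace QueueControl

/-! ### Ultralimits of approximately invariant laws -/

/-- A limit along an ultrafilter of a tight family of approximately invariant subdistributions is
an invariant distribution. -/
theorem exists_invariant_ultralimit {J S : Type*} (U : Ultrafilter J) (p : J → S → ℝ≥0∞)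
    (hp : ∀ j, ∑' x, p j x ≤ 1) (K : J → S → PMF S) (κ : S → PMF S)
    (hK : ∀ y x, Tendsto (fun j => K j y x) U (𝓝 (κ y x)))
    (ε : J → ℝ≥0∞) (hε : Tendsto ε U (𝓝 0))
    (hinv : ∀ᶠ j in (U : Filter J), ∀ x, ∑' y, p j y * K j y x ≤ p j x + ε j)
    (htight : ∀ r : ℝ≥0∞, 0 < r → ∃ F : Finset S, ∀ᶠ j in (U : Filter J),
      1 ≤ ∑ x ∈ F, p j x + r) :
    ∃ d : PMF S, d.bind κ = d ∧ ∀ x, Tendsto (fun j => p j x) U (𝓝 (d x)) := by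
  have hlim : ∀ x, ∃ v : ℝ≥0∞, Tendsto (fun j => p j x) U (𝓝 v) := fun x => by
    obtain ⟨v, -, hv⟩ := isCompact_univ.ultrafilter_le_nhds (U.map fun j => p j x) (by simp)
    exact ⟨v, hv⟩
  choose v hv using hlim
  have hsum : ∀ F : Finset S, Tendsto (fun j => ∑ x ∈ F, p j x) U (𝓝 (∑ x ∈ F, v x)) :=
    fun F => tendsto_finsetSum _ fun x _ => hv x
  have hle : ∑' x, v x ≤ 1 := by
    rw [ENNReal.tsum_eq_iSup_sum]
    exact iSup_le fun F => le_of_tendsto' (hsum F) fun j => (ENNReal.sum_le_tsum F).trans (hp j)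
  have hge : 1 ≤ ∑' x, v x := by
    refine ENNReal.le_of_forall_pos_le_add fun r hr _ => ?_
    obtain ⟨F, hF⟩ := htight r (by exact_mod_cast hr)
    exact (ge_of_tendsto ((hsum F).add_const _) hF).trans (by gcongr; exact ENNReal.sum_le_tsum F)
  have hv1 : ∑' x, v x = 1 := le_antisymm hle hge
  have hvtop : ∀ x, v x ≠ ⊤ := fun x =>
    ne_top_of_le_ne_top ENNReal.one_ne_top ((ENNReal.le_tsum x).trans hle)
  let d : PMF S := ⟨v, hv1 ▸ ENNReal.summable.hasSum⟩
  have hdv : ∀ x, d x = v x := fun _ => rfl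
  -- Only finite partial sums pass to the limit, so this gives an inequality as in Fatou's lemma.
  -- Both sides have total mass one, which forces equality.
  have hsub : ∀ x, (d.bind κ) x ≤ d x := fun x => by
    rw [PMF.bind_apply, ENNReal.tsum_eq_iSup_sum]
    refine iSup_le fun F => ?_
    have h1 : Tendsto (fun j => ∑ y ∈ F, p j y * K j y x) U (𝓝 (∑ y ∈ F, v y * κ y x)) :=
      tendsto_finsetSum _ fun y _ => ENNReal.Tendsto.mul (hv y) (Or.inr ((κ y).apply_ne_top x))
        (hK y x) (Or.inr (hvtop y))
    have h2 : Tendsto (fun j => p j x + ε j) U (𝓝 (v x + 0)) := (hv x).add hε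
    rw [add_zero] at h2
    exact le_of_tendsto_of_tendsto h1 h2
      (hinv.mono fun j hj => (ENNReal.sum_le_tsum F).trans (hj x))
  refine ⟨d, ?_, hv⟩
  ext x
  by_contra hne
  have hlt : (d.bind κ) x < d x := lt_of_le_of_ne (hsub x) hne
  have := ENNReal.tsum_lt_tsum (by rw [PMF.tsum_coe]; exact ENNReal.one_ne_top) hsub hlt
  rw [PMF.tsum_coe, PMF.tsum_coe] at this
  exact lt_irrefl _ this

/-! ### The chain killed on the finite set, and domination of stationary laws -/

open Classical in
/-- The action on (unnormalized) distributions of the kernel `κ` killed on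
`L`. -/
noncomputable def taboo {S : Type*} (L : Finset S) (κ : S → PMF S) :
    (S → ℝ≥0∞) →ₗ[ℝ≥0∞] (S → ℝ≥0∞) where
  toFun m x := ∑' y, m y * (if y ∈ L ∨ x ∈ L then 0 else κ y x)
  map_add' m n := by
    ext x
    simp only [Pi.add_apply, add_mul, ENNReal.tsum_add]
  map_smul' c m := by
    ext x
    simp only [Pi.smul_apply, smul_eq_mul, RingHom.id_apply, mul_assoc, ENNReal.tsum_mul_left]

section taboo

variable {S : Type*} {L : Finset S} {κ : S → PMF S}

open Classical in
theorem taboo_apply (m : S → ℝ≥0∞) (x : S) :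
    taboo L κ m x = ∑' y, m y * (if y ∈ L ∨ x ∈ L then 0 else κ y x) := rfl

theorem taboo_mono {m n : S → ℝ≥0∞} (h : m ≤ n) : taboo L κ m ≤ taboo L κ n := fun x => by
  simp only [taboo_apply]
  exact ENNReal.tsum_le_tsum fun y => mul_le_mul_left (h y) _

theorem taboo_of_mem (m : S → ℝ≥0∞) {x : S} (hx : x ∈ L) : taboo L κ m x = 0 := by
  simp [taboo_apply, hx]

/-- The killed operator never uses a row indexed by `L`, so all perturbations on `L` share it. -/
theorem taboo_congr {κ' : S → PMF S} (h : ∀ y ∉ L, κ' y = κ y) : taboo L κ' = taboo L κ := by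
  ext m x
  simp only [taboo_apply]
  refine tsum_congr fun y => ?_
  by_cases hy : y ∈ L
  · simp [hy]
  · rw [h y hy]

theorem taboo_tsum {ι : Type*} (f : ι → S → ℝ≥0∞) :
    taboo L κ (fun x => ∑' i, f i x) = fun x => ∑' i, taboo L κ (f i) x := by
  ext x
  simp only [taboo_apply, ← ENNReal.tsum_mul_right]
  exact ENNReal.tsum_comm

/-- Expected numbers of visits of the killed chain with entrance distribution `ν`. -/
noncomputable def visits (L : Finset S) (κ : S → PMF S) (ν : S → ℝ≥0∞) (x : S) : ℝ≥0∞ :=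
  ∑' k : ℕ, ((taboo L κ) ^ k) ν x

theorem visits_eq (ν : S → ℝ≥0∞) : visits L κ ν = ν + taboo L κ (visits L κ ν) := by
  ext x
  unfold visits
  rw [Pi.add_apply, taboo_tsum, tsum_eq_zero_add' ENNReal.summable]
  simp [pow_succ']

theorem visits_sum {J : Type*} (P : Finset J) (B : J → ℝ≥0∞) (ν : J → S → ℝ≥0∞) :
    visits L κ (∑ j ∈ P, B j • ν j) = ∑ j ∈ P, B j • visits L κ (ν j) := by
  ext x
  simp only [visits, map_sum, map_smul, Finset.sum_apply, Pi.smul_apply, smul_eq_mul,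
    ← ENNReal.tsum_mul_left]
  exact Summable.tsum_finsetSum fun _ _ => ENNReal.summable

/-- The expected visits are the minimal solution of m = ν + m·(killed kernel): by induction, every
partial sum of the series stays below any supersolution. -/
theorem visits_le {ν m : S → ℝ≥0∞} (h : ν + taboo L κ m ≤ m) : visits L κ ν ≤ m := by
  have key : ∀ n : ℕ, ∑ k ∈ Finset.range n, ((taboo L κ) ^ k) ν ≤ m := by
    intro n
    induction n with
    | zero => simp
    | succ n ih =>
      rw [Finset.sum_range_succ']
      refine le_trans ?_ h
      rw [add_comm]
      refine add_le_add (by simp) ?_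
      refine le_trans (le_of_eq ?_) (taboo_mono ih)
      rw [map_sum]
      simp [pow_succ']
  intro x
  unfold visits
  refine ENNReal.tsum_le_of_sum_range_le fun n => ?_
  simpa using key n x

/-- A nonzero finite invariant measure of the killed chain normalizes to a stationary
distribution. -/
theorem invariant_of_taboo_eq {r : S → ℝ≥0∞} (hr : taboo L κ r = r) (hfin : ∑' x, r x ≠ ⊤)
    (h0 : ∑' x, r x ≠ 0) :
    (PMF.normalize r h0 hfin).bind κ = PMF.normalize r h0 hfin := by
  classical
  -- Killing only removes mass, so r is dominated by its image under κ; the total masses agree and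
  -- are finite, so the two are equal.
  have hle : ∀ x, r x ≤ ∑' y, r y * κ y x := fun x => by
    conv_lhs => rw [← hr, taboo_apply]
    refine ENNReal.tsum_le_tsum fun y => ?_
    gcongr
    split_ifs <;> simp
  have htot : ∑' x, ∑' y, r y * κ y x = ∑' x, r x := by
    rw [ENNReal.tsum_comm]
    simp [ENNReal.tsum_mul_left]
  have heq : ∀ x, ∑' y, r y * κ y x = r x := fun x => by
    by_contra hne
    have := ENNReal.tsum_lt_tsum hfin hle (lt_of_le_of_ne (hle x) (Ne.symm hne))
    exact this.ne htot.symm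
  ext x
  simp only [PMF.bind_apply, PMF.normalize_apply]
  rw [← heq x, ← ENNReal.tsum_mul_right]
  exact tsum_congr fun y => by ring

end taboo

open Classical in
/-- Let `κ` have the unique stationary distribution `d`.  The stationary distributions of the
perturbations of `κ` on the finite set `L` that leave `L` by mixing finitely many fixed entrance
distributions are dominated, off `L`, by one summable function. -/
theorem exists_summable_dominating {S J : Type*} (L : Finset S) (κ : S → PMF S) (d : PMF S)
    (hd : ∀ d₁ : PMF S, d₁.bind κ = d₁ → d₁ = d) (P : Finset J) (ν : J → PMF S) :
    ∃ D : S → ℝ≥0∞, ∑' x, D x ≠ ⊤ ∧ ∀ (κ' : S → PMF S) (d' : PMF S) (B : J → ℝ≥0∞),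
      (∀ y ∉ L, κ' y = κ y) → (∀ d₁ : PMF S, d₁.bind κ' = d₁ → d₁ = d') → d'.bind κ' = d' →
      (∀ j ∈ P, B j ≤ 1) →
      (∀ x, ∑ y ∈ L, d' y * κ' y x = ∑ j ∈ P, B j * ν j x) → ∀ x, x ∉ L → d' x ≤ D x := by
  let e : J → S → ℝ≥0∞ := fun j x => if x ∈ L then 0 else ν j x
  let N : J → S → ℝ≥0∞ := fun j => visits L κ (e j)
  -- The term d covers the case of a nonzero invariant remainder. Entrance laws with infinite
  -- expected visits are dropped because their coefficient must vanish.
  refine ⟨fun x => d x + ∑ j ∈ P with ∑' x, N j x ≠ ⊤, N j x, ?_, ?_⟩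
  · rw [ENNReal.tsum_add, Summable.tsum_finsetSum fun _ _ => ENNReal.summable]
    refine ENNReal.add_ne_top.2 ⟨by simp, ENNReal.sum_ne_top.2 fun j hj => (Finset.mem_filter.1 hj).2⟩
  intro κ' d' B hκ hd' hstat hB hent x hx
  let m : S → ℝ≥0∞ := fun x => if x ∈ L then 0 else d' x
  -- The balance equation of d' off L, split by whether the previous state lies in L (entrance) or
  -- not (killed chain).
  have hm : m = ∑ j ∈ P, B j • e j + taboo L κ m := by
    ext x
    rw [Pi.add_apply, ← taboo_congr hκ]
    by_cases hxL : x ∈ L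
    · rw [taboo_of_mem _ hxL]
      simp [m, e, hxL]
    · have h1 : d' x = ∑' y, d' y * κ' y x := by rw [← PMF.bind_apply, hstat]
      have h2 : taboo L κ' m x = ∑' y, (if y ∈ L then 0 else d' y * κ' y x) := by
        rw [taboo_apply]
        refine tsum_congr fun y => ?_
        by_cases hy : y ∈ L <;> simp [m, hy, hxL]
      have h3 : (∑ j ∈ P, B j • e j) x = ∑' y, (if y ∈ L then d' y * κ' y x else 0) := by
        rw [tsum_eq_sum (s := L) fun y hy => by simp [hy]]
        rw [Finset.sum_congr rfl fun y hy => if_pos hy, hent x]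
        simp [e, hxL]
      rw [h2, h3, ← ENNReal.tsum_add]
      simp only [m, hxL, if_false, h1]
      exact tsum_congr fun y => by split_ifs <;> simp
  have hm1 : ∑' x, m x ≤ 1 := by
    rw [← PMF.tsum_coe d']
    exact ENNReal.tsum_le_tsum fun x => by simp only [m]; split_ifs <;> simp
  have hmtop : ∀ x, m x ≠ ⊤ := fun x => by
    simp only [m]; split_ifs
    · simp
    · exact d'.apply_ne_top x
  let G : S → ℝ≥0∞ := visits L κ (∑ j ∈ P, B j • e j)
  have hGm : G ≤ m := visits_le hm.ge
  have hG : G = ∑ j ∈ P, B j • e j + taboo L κ G := visits_eq _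
  have hGtop : ∀ x, G x ≠ ⊤ := fun x => ne_top_of_le_ne_top (hmtop x) (hGm x)
  -- What the minimal solution leaves over is a finite measure invariant under the killed chain.
  let r : S → ℝ≥0∞ := fun x => m x - G x
  have hmr : m = G + r := by ext x; exact (add_tsub_cancel_of_le (hGm x)).symm
  have hr : taboo L κ r = r := by
    ext x
    have h1 : G x + taboo L κ r x = G x + r x := by
      have h2 : m x = (G + taboo L κ r) x := by
        conv_lhs => rw [hm, hmr, map_add, ← add_assoc, ← hG]
      rw [hmr] at h2
      exact h2.symm
    exact (ENNReal.add_right_inj (hGtop x)).1 h1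
  have hrm : ∀ x, r x ≤ m x := fun x => tsub_le_self
  have hrfin : ∑' x, r x ≠ ⊤ :=
    ne_top_of_le_ne_top ENNReal.one_ne_top ((ENNReal.tsum_le_tsum hrm).trans hm1)
  by_cases h0 : ∑' x, r x = 0
  · have hr0 : r = 0 := by ext x; exact (ENNReal.tsum_eq_zero.1 h0) x
    have hmG : m = ∑ j ∈ P, B j • N j := by rw [hmr, hr0, add_zero]; exact visits_sum P B e
    have hdx : d' x = ∑ j ∈ P, B j * N j x := by
      have := congrFun hmG x
      simpa [m, hx] using this
    rw [hdx]
    refine le_add_left ?_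
    rw [Finset.sum_filter]
    refine Finset.sum_le_sum fun j hj => ?_
    split_ifs with hj'
    · exact mul_le_of_le_one_left' (hB j hj)
    · have hle : B j * ∑' x, N j x ≤ 1 := by
        rw [← ENNReal.tsum_mul_left]
        refine le_trans (ENNReal.tsum_le_tsum fun x => ?_) hm1
        rw [hmG, Finset.sum_apply]
        exact Finset.single_le_sum (f := fun j => (B j • N j) x) (fun _ _ => zero_le) hj
      rw [not_not.1 hj'] at hle
      have : B j = 0 := by
        by_contra hB0
        rw [ENNReal.mul_top hB0] at hle
        exact absurd hle (by simp)
      simp [this]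
  -- A nonzero remainder normalizes to a stationary law of both κ and κ'; the two uniqueness
  -- hypotheses give d' = d.
  · have e1 := hd _ (invariant_of_taboo_eq hr hrfin h0)
    have e2 := hd' _ (invariant_of_taboo_eq (by rw [taboo_congr hκ]; exact hr) hrfin h0)
    rw [← e2, e1]
    exact le_self_add

/-! ### Expectations under mixtures -/

section expect

variable {X Y : Type*}

theorem expect_eq_sum {F : Type*} [AddCommMonoid F] [Module ℝ F] [TopologicalSpace F]
    (μ : PMF X) (f : X → F) (s : Finset X) (h : ∀ x ∉ s, (μ x).toReal • f x = 0) :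
    expect μ f = ∑ x ∈ s, (μ x).toReal • f x :=
  tsum_eq_sum fun x hx => h x hx

theorem expect_pure (x : X) (f : X → ℝ) : expect (PMF.pure x) f = f x := by
  rw [expect_eq_sum _ _ {x} fun y hy => by
    rw [PMF.pure_apply_of_ne _ _ (by simpa using hy)]; simp]
  simp

theorem summable_of_support_finite {μ : PMF X} (h : μ.support.Finite) (f : X → ℝ) :
    Summable fun x => (μ x).toReal * f x :=
  summable_of_hasFiniteSupport (h.subset fun x hx => by
    rw [PMF.mem_support_iff]
    rintro h0
    simp [h0] at hx)

theorem expect_add {μ : PMF X} (h : μ.support.Finite) (f g : X → ℝ) :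
    expect μ (fun x => f x + g x) = expect μ f + expect μ g := by
  simp only [expect, smul_eq_mul, mul_add]
  exact (summable_of_support_finite h f).tsum_add (summable_of_support_finite h g)

theorem summable_toReal_bind (μ : PMF X) (κ : X → PMF Y) (y : Y) :
    Summable fun x => (μ x).toReal * (κ x y).toReal := by
  have := ENNReal.summable_toReal ((μ.bind κ).apply_ne_top y)
  simpa [ENNReal.toReal_mul] using this

theorem bind_apply_toReal (μ : PMF X) (κ : X → PMF Y) (y : Y) :
    ((μ.bind κ) y).toReal = ∑' x, (μ x).toReal * (κ x y).toReal := by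
  rw [PMF.bind_apply, ENNReal.tsum_toReal_eq fun x =>
    ENNReal.mul_ne_top (μ.apply_ne_top x) ((κ x).apply_ne_top y)]
  simp

/-- Fubini: the weights are nonnegative, so absolute convergence under the mixture gives summability
on the product. No finite support is required, as needed for an arbitrary initial law. -/
theorem hasSum_expect_bind (μ : PMF X) (κ : X → PMF Y) (f : Y → ℝ)
    (h : Summable fun y => ((μ.bind κ) y).toReal * f y) :
    HasSum (fun x => (μ x).toReal * expect (κ x) f) (expect (μ.bind κ) f) := by
  have hG : Summable (Function.uncurry fun (y : Y) (x : X) =>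
      (μ x).toReal * (κ x y).toReal * f y) := by
    refine Summable.of_norm ?_
    refine (summable_prod_of_nonneg fun _ => norm_nonneg _).2 ⟨fun y => ?_, ?_⟩
    · simpa [Function.uncurry, abs_mul] using (summable_toReal_bind μ κ y).mul_right |f y|
    · refine h.norm.congr fun y => ?_
      simp only [Function.uncurry, norm_mul, tsum_mul_right]
      rw [bind_apply_toReal, Real.norm_of_nonneg (tsum_nonneg fun x => by positivity)]
      simp
  have h1 : expect (μ.bind κ) f = ∑' x, ∑' y, (μ x).toReal * (κ x y).toReal * f y := by
    rw [hG.tsum_comm]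
    simp only [expect, smul_eq_mul, bind_apply_toReal, tsum_mul_right]
  have h2 : ∀ x, ∑' y, (μ x).toReal * (κ x y).toReal * f y = (μ x).toReal * expect (κ x) f :=
    fun x => by simp only [expect, smul_eq_mul, mul_assoc, tsum_mul_left]
  simp only [h2] at h1
  rw [h1]
  refine Summable.hasSum ?_
  simp only [← h2]
  exact hG.prod_symm.prod

end expect

/-! ### Iterated kernels and Duhamel's formula -/

section iter

variable {S : Type*}

/-- The `t`-step transition distributions of the kernel `κ`. -/
noncomputable def iter (κ : S → PMF S) : ℕ → S → PMF S
  | 0 => PMF.pure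
  | t + 1 => fun s => (iter κ t s).bind κ

theorem finite_support_bind {X Y : Type*} {μ : PMF X} {κ : X → PMF Y} (h : μ.support.Finite)
    (hκ : ∀ x ∈ μ.support, (κ x).support.Finite) : (μ.bind κ).support.Finite := by
  rw [PMF.support_bind]
  exact h.biUnion hκ

theorem iter_finite {κ : S → PMF S} (h : ∀ s, (κ s).support.Finite) (t : ℕ) (s : S) :
    (iter κ t s).support.Finite := by
  induction t with
  | zero => simp [iter, PMF.support_pure]
  | succ t ih => exact finite_support_bind ih fun x _ => h x

theorem expect_bind {X Y : Type*} {μ : PMF X} {κ : X → PMF Y} (h : μ.support.Finite)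
    (hκ : ∀ x ∈ μ.support, (κ x).support.Finite) (f : Y → ℝ) :
    expect (μ.bind κ) f = expect μ fun x => expect (κ x) f :=
  ((hasSum_expect_bind μ κ f
    (summable_of_support_finite (finite_support_bind h hκ) f)).tsum_eq).symm

/-- Duhamel's formula for two kernels that agree off the finite set `L`. -/
theorem expect_iter_sub {κ κ' : S → PMF S} (h : ∀ s, (κ s).support.Finite)
    (h' : ∀ s, (κ' s).support.Finite) (L : Finset S) (hL : ∀ s ∉ L, κ' s = κ s)
    (T : ℕ) (f : S → ℝ) (s₀ : S) :
    expect (iter κ' T s₀) f = expect (iter κ T s₀) f +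
      ∑ k ∈ Finset.range T, ∑ s ∈ L, (iter κ' k s₀ s).toReal *
        (expect (κ' s) (fun x => expect (iter κ (T - 1 - k) x) f) -
          expect (κ s) (fun x => expect (iter κ (T - 1 - k) x) f)) := by
  induction T generalizing f with
  | zero => simp [iter]
  | succ T ih =>
    have e1 : expect (iter κ' (T + 1) s₀) f = expect (iter κ' T s₀) fun x => expect (κ' x) f :=
      expect_bind (iter_finite h' T s₀) (fun x _ => h' x) f
    have e2 : ∀ n s, expect (iter κ n s) (fun x => expect (κ x) f) = expect (iter κ (n + 1) s) f :=
      fun n s => (expect_bind (iter_finite h n s) (fun x _ => h x) f).symm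
    -- The last step under κ' is a step under κ plus a defect supported on L: the former goes into
    -- the induction hypothesis, the latter is the new term k = T.
    have e3 : (fun x => expect (κ' x) f) =
        fun x => expect (κ x) f + (expect (κ' x) f - expect (κ x) f) := by
      ext x; ring
    rw [e1, e3, expect_add (iter_finite h' T s₀), ih, Finset.sum_range_succ, e2, ← add_assoc]
    congr 1
    · congr 1
      refine Finset.sum_congr rfl fun k hk => Finset.sum_congr rfl fun s _ => ?_
      have hk' : T - 1 - k + 1 = T + 1 - 1 - k := by have := Finset.mem_range.1 hk; omega
      simp only [e2, hk']
    · rw [expect_eq_sum _ _ L fun s hs => by simp [hL s hs]]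
      simp [iter, expect_pure]

end iter

/-! ### Cesàro means and occupation measures -/

/-- Cesàro means of a convolution. -/
theorem tendsto_cesaro_convolution {m w : ℕ → ℝ} {d W : ℝ} (hm : ∀ k, |m k| ≤ 1)
    (hd : Tendsto (fun N : ℕ => (∑ k ∈ Finset.range N, m k) / (N : ℝ)) atTop (𝓝 d))
    (hw : Tendsto (fun N : ℕ => ∑ j ∈ Finset.range N, w j) atTop (𝓝 W)) :
    Tendsto (fun N : ℕ => (∑ T ∈ Finset.range N, ∑ k ∈ Finset.range T, m k * w (T - 1 - k)) /
      (N : ℝ)) atTop (𝓝 (d * W)) := by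
  let V : ℕ → ℝ := fun n => ∑ j ∈ Finset.range n, w j
  -- Summing over T first replaces w by its partial sums V.
  have key : ∀ N : ℕ, ∑ T ∈ Finset.range N, ∑ k ∈ Finset.range T, m k * w (T - 1 - k) =
      ∑ k ∈ Finset.range N, m k * V (N - 1 - k) := by
    intro N
    induction N with
    | zero => simp
    | succ N ih =>
      rw [Finset.sum_range_succ, ih, ← Finset.sum_add_distrib, Finset.sum_range_succ]
      have : m N * V (N + 1 - 1 - N) = 0 := by simp [V]
      rw [this, add_zero]
      refine Finset.sum_congr rfl fun k hk => ?_
      have hk' : N + 1 - 1 - k = (N - 1 - k) + 1 := by have := Finset.mem_range.1 hk; omega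
      rw [hk', show V (N - 1 - k + 1) = V (N - 1 - k) + w (N - 1 - k) from Finset.sum_range_succ _ _]
      ring
  have hV : Tendsto (fun n => |V n - W|) atTop (𝓝 0) := by
    have := (hw.sub_const W).abs
    simpa using this
  have hces := hV.cesaro
  -- As |m| ≤ 1, the error is at most the Cesàro mean of |V - W|, read in reverse order.
  have hrest : Tendsto (fun N : ℕ => (∑ k ∈ Finset.range N, m k * (V (N - 1 - k) - W)) / (N : ℝ))
      atTop (𝓝 0) := by
    refine squeeze_zero_norm (fun N => ?_) hces
    rw [norm_div, div_eq_inv_mul, RCLike.norm_natCast]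
    refine mul_le_mul_of_nonneg_left ?_ (by positivity)
    rw [← Finset.sum_range_reflect (fun i => |V i - W|)]
    refine (norm_sum_le _ _).trans (Finset.sum_le_sum fun k _ => ?_)
    rw [norm_mul]
    exact mul_le_of_le_one_left (norm_nonneg _) (hm k)
  have := (hd.mul_const W).add hrest
  rw [add_zero] at this
  refine this.congr fun N => ?_
  rw [key, div_mul_eq_mul_div, ← add_div, Finset.sum_mul, ← Finset.sum_add_distrib]
  congr 1
  exact Finset.sum_congr rfl fun k _ => by ring

/-- Mean occupation of `x` during the first `T` steps of the chain started at `s₀`. -/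
noncomputable def occupation {S : Type*} (κ : S → PMF S) (s₀ : S) (T : ℕ) (x : S) : ℝ≥0∞ :=
  (∑ t ∈ Finset.range T, iter κ t s₀ x) / (T : ℝ≥0∞)

section occupation

variable {S : Type*} (κ : S → PMF S) (s₀ : S)

theorem tsum_occupation_mul (T : ℕ) (f : S → ℝ≥0∞) :
    ∑' x, occupation κ s₀ T x * f x =
      (∑ t ∈ Finset.range T, ∑' x, iter κ t s₀ x * f x) / (T : ℝ≥0∞) := by
  rw [← Summable.tsum_finsetSum fun _ _ => ENNReal.summable, div_eq_mul_inv,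
    ← ENNReal.tsum_mul_right]
  refine tsum_congr fun x => ?_
  rw [occupation, ← Finset.sum_mul, div_eq_mul_inv, mul_right_comm]

theorem tsum_occupation {T : ℕ} (hT : T ≠ 0) : ∑' x, occupation κ s₀ T x = 1 := by
  have := tsum_occupation_mul κ s₀ T 1
  simp only [Pi.one_apply, mul_one, PMF.tsum_coe, Finset.sum_const, Finset.card_range,
    nsmul_eq_mul] at this
  rw [this]
  exact ENNReal.div_self (by simpa using hT) (by simp)

theorem tsum_occupation_le (T : ℕ) : ∑' x, occupation κ s₀ T x ≤ 1 := by
  rcases eq_or_ne T 0 with rfl | hT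
  · simp [occupation]
  · exact (tsum_occupation κ s₀ hT).le

theorem occupation_le_one (T : ℕ) (x : S) : occupation κ s₀ T x ≤ 1 :=
  (ENNReal.le_tsum x).trans (tsum_occupation_le κ s₀ T)

/-- Advancing one step shifts the time window, which adds at most one term of size 1/T. -/
theorem occupation_step_le (T : ℕ) (x : S) :
    ∑' y, occupation κ s₀ T y * κ y x ≤ occupation κ s₀ T x + (T : ℝ≥0∞)⁻¹ := by
  rw [tsum_occupation_mul]
  have h : ∀ t, ∑' y, iter κ t s₀ y * κ y x = iter κ (t + 1) s₀ x := fun t => rfl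
  simp only [h, occupation]
  rw [← one_div, ← ENNReal.add_div]
  gcongr
  calc ∑ t ∈ Finset.range T, iter κ (t + 1) s₀ x
      ≤ ∑ t ∈ Finset.range (T + 1), iter κ t s₀ x := by
        rw [Finset.sum_range_succ']; exact le_self_add
    _ ≤ _ := by
        rw [Finset.sum_range_succ]; gcongr; exact PMF.coe_le_one _ _

end occupation

/-! ### Tightness from strong stability, and the ergodic limit -/

section network

variable {ι Y A : Type*} {M : NetworkMDP ι Y A}

theorem stateLaw_eq (π : Policy M) (ρ : PMF (NetState ι Y)) (t : ℕ) :
    stateLaw M π ρ t = ρ.bind (iter (step M π) t) := by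
  induction t with
  | zero => exact (PMF.bind_pure ρ).symm
  | succ t ih =>
    rw [stateLaw, ih, PMF.bind_bind]
    rfl

theorem act_finite (π : Policy M) (s : NetState ι Y) : (π.act s).support.Finite :=
  (M.valid s).finite_toSet.subset (π.support_subset s)

theorem trans_finite_of_mem (π : Policy M) (s : NetState ι Y) :
    ∀ a ∈ (π.act s).support, (M.trans s a).support.Finite :=
  fun a ha => M.trans_finite s a (π.support_subset s ha)

theorem step_finite (π : Policy M) (s : NetState ι Y) : (step M π s).support.Finite :=
  finite_support_bind (act_finite π s) (trans_finite_of_mem π s)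

theorem tight_of_isStronglyStable [Fintype ι] [Finite Y] {π : Policy M}
    (h : IsStronglyStable M π) (s₀ : NetState ι Y) {r : ℝ≥0∞} (hr : 0 < r) :
    ∃ F : Finset (NetState ι Y), ∀ᶠ T : ℕ in atTop,
      1 ≤ ∑ x ∈ F, occupation (step M π) s₀ T x + r := by
  classical
  have hK : ∀ i, ∃ K : ℝ≥0∞, K ≠ ⊤ ∧ ∀ᶠ T : ℕ in atTop,
      ∑' s, occupation (step M π) s₀ T s * (s.1 i : ℝ≥0∞) ≤ K := fun i => by
    obtain ⟨K, hK1, hK2⟩ := exists_between (h s₀ i)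
    refine ⟨K, hK2.ne, (eventually_lt_of_limsup_lt hK1).mono fun T hT => ?_⟩
    rw [tsum_occupation_mul]
    simpa only [stateLaw_eq, PMF.pure_bind] using hT.le
  choose K hKtop hK using hK
  have hKs : (∑ i, K i) / r ≠ ⊤ :=
    ENNReal.div_ne_top (ENNReal.sum_ne_top.2 fun i _ => hKtop i) hr.ne'
  obtain ⟨n, hn⟩ := ENNReal.exists_nat_gt hKs
  have hn0 : (n : ℝ≥0∞) ≠ 0 := (zero_le.trans_lt hn).ne'
  have hfin : {s : NetState ι Y | ∀ i, s.1 i < n}.Finite := by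
    have h1 : (Set.univ.pi fun _ : ι => Set.Iio n).Finite :=
      Set.Finite.pi fun _ => Set.finite_Iio n
    refine (h1.prod (Set.finite_univ (α := Y))).subset fun s hs => ?_
    exact ⟨fun i _ => hs i, Set.mem_univ _⟩
  refine ⟨hfin.toFinset, ?_⟩
  filter_upwards [eventually_all.2 hK, eventually_ne_atTop 0] with T hT hT0
  -- Markov's inequality: outside the box some queue has length at least n, so 1 ≤ ∑ᵢ qᵢ/n there; n
  -- was chosen with ∑ᵢ Kᵢ/n ≤ r.
  have hpt : ∀ s, occupation (step M π) s₀ T s ≤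
      (if s ∈ hfin.toFinset then occupation (step M π) s₀ T s else 0) +
        ∑ i, occupation (step M π) s₀ T s * (s.1 i : ℝ≥0∞) * (n : ℝ≥0∞)⁻¹ := fun s => by
    split_ifs with hs
    · exact le_self_add
    · rw [zero_add]
      simp only [Set.Finite.mem_toFinset, Set.mem_ofPred_eq, not_forall, not_lt] at hs
      obtain ⟨i, hi⟩ := hs
      refine le_trans ?_ (Finset.single_le_sum (fun _ _ => zero_le) (Finset.mem_univ i))
      rw [mul_assoc]
      refine le_mul_of_one_le_right' ?_
      rw [← div_eq_mul_inv, ENNReal.le_div_iff_mul_le (Or.inl hn0) (Or.inl (by simp)), one_mul]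
      exact_mod_cast hi
  calc (1 : ℝ≥0∞) = ∑' s, occupation (step M π) s₀ T s := (tsum_occupation _ _ hT0).symm
    _ ≤ _ := ENNReal.tsum_le_tsum hpt
    _ = ∑ s ∈ hfin.toFinset, occupation (step M π) s₀ T s +
        ∑ i, (∑' s, occupation (step M π) s₀ T s * (s.1 i : ℝ≥0∞)) * (n : ℝ≥0∞)⁻¹ := by
      rw [ENNReal.tsum_add, Summable.tsum_finsetSum fun _ _ => ENNReal.summable]
      simp only [ENNReal.tsum_mul_right]
      congr 1
      rw [tsum_eq_sum (s := hfin.toFinset) fun s hs => if_neg hs]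
      exact Finset.sum_congr rfl fun s hs => if_pos hs
    _ ≤ _ := by
      gcongr
      rw [← Finset.sum_mul, ← div_eq_mul_inv]
      refine le_trans (ENNReal.div_le_div_right (Finset.sum_le_sum fun i _ => hT i) _) ?_
      refine ENNReal.div_le_of_le_mul ?_
      exact (ENNReal.div_le_iff_le_mul (Or.inl hr.ne') (Or.inr (by simp [hn0]))).1 hn.le |>.trans
        (by rw [mul_comm])

/-- A strongly stable chain with at most one stationary distribution has one, and its mean
occupations converge to it. -/
theorem exists_tendsto_occupation [Fintype ι] [Finite Y] {π : Policy M}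
    (h : IsStronglyStable M π)
    (hu : ∀ d₁ d₂ : PMF (NetState ι Y), IsSteadyState M π d₁ → IsSteadyState M π d₂ → d₁ = d₂) :
    ∃ d : PMF (NetState ι Y), IsSteadyState M π d ∧
      ∀ s₀ x, Tendsto (fun T => occupation (step M π) s₀ T x) atTop (𝓝 (d x)) := by
  have key : ∀ s₀ (U : Ultrafilter ℕ), (U : Filter ℕ) ≤ atTop →
      ∃ d : PMF (NetState ι Y), IsSteadyState M π d ∧
        ∀ x, Tendsto (fun T => occupation (step M π) s₀ T x) U (𝓝 (d x)) := fun s₀ U hU =>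
    exists_invariant_ultralimit U (occupation (step M π) s₀) (tsum_occupation_le _ _)
      (fun _ => step M π) (step M π) (fun _ _ => tendsto_const_nhds) _
      (ENNReal.tendsto_inv_nat_nhds_zero.mono_left hU)
      (Eventually.of_forall fun T => occupation_step_le _ _ T)
      fun r hr => (tight_of_isStronglyStable h s₀ hr).imp fun F hF => hF.filter_mono hU
  obtain ⟨z, -⟩ := M.init.support_nonempty
  obtain ⟨d, hd, -⟩ := key z (Ultrafilter.of atTop) (Ultrafilter.of_le _)
  refine ⟨d, hd, fun s₀ x => (tendsto_iff_ultrafilter _ _ _).2 fun U hU => ?_⟩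
  obtain ⟨d', hd', hlim⟩ := key s₀ U hU
  rw [hu d d' hd hd']
  exact hlim x

/-- Stability concerns deterministic starts; since occupations are at most one, dominated
convergence carries the limit to any initial law. -/
theorem tendsto_cesaro_stateLaw {π : Policy M} {d : PMF (NetState ι Y)}
    (h : ∀ s₀ x, Tendsto (fun T => occupation (step M π) s₀ T x) atTop (𝓝 (d x)))
    (ρ : PMF (NetState ι Y)) (x : NetState ι Y) :
    Tendsto (fun T : ℕ => (∑ t ∈ Finset.range T, (stateLaw M π ρ t x).toReal) / (T : ℝ)) atTop
      (𝓝 (d x).toReal) := by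
  have hsum : Summable fun s => (ρ s).toReal := ENNReal.summable_toReal (by simp)
  have hone : ∑' s, (ρ s).toReal = 1 := by
    rw [← ENNReal.tsum_toReal_eq fun s => ρ.apply_ne_top s]; simp
  have hlim := tendsto_tsum_of_dominated_convergence (𝓕 := atTop)
    (f := fun (T : ℕ) s => (ρ s).toReal * (occupation (step M π) s T x).toReal)
    (g := fun s => (ρ s).toReal * (d x).toReal) hsum
    (fun s => ((ENNReal.tendsto_toReal (d.apply_ne_top x)).comp (h s x)).const_mul _)
    (Eventually.of_forall fun T s => by
      rw [norm_mul, Real.norm_of_nonneg ENNReal.toReal_nonneg,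
        Real.norm_of_nonneg ENNReal.toReal_nonneg]
      refine mul_le_of_le_one_right ENNReal.toReal_nonneg ?_
      exact ENNReal.toReal_mono ENNReal.one_ne_top (occupation_le_one _ s T x))
  rw [tsum_mul_right, hone, one_mul] at hlim
  refine hlim.congr fun T => ?_
  have hocc : ∀ s, (occupation (step M π) s T x).toReal =
      (∑ t ∈ Finset.range T, (iter (step M π) t s x).toReal) / T := fun s => by
    rw [occupation, ENNReal.toReal_div, ENNReal.toReal_sum fun t _ => PMF.apply_ne_top _ _]
    simp
  simp only [hocc, mul_div_assoc', Finset.mul_sum, tsum_div_const]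
  rw [Summable.tsum_finsetSum fun t _ => summable_toReal_bind ρ (iter (step M π) t) x]
  simp only [stateLaw_eq, bind_apply_toReal]

end network

/-! ### Performance difference formula -/

section performance

variable {ι Y A : Type*} {M : NetworkMDP ι Y A}

theorem act_eq_zero (π : Policy M) (s : NetState ι Y) {a : A} (ha : a ∉ M.valid s) :
    π.act s a = 0 := by
  by_contra h
  exact ha (π.support_subset s ((PMF.mem_support_iff _ _).2 h))

theorem expect_act {F : Type*} [AddCommMonoid F] [Module ℝ F] [TopologicalSpace F]
    (π : Policy M) (s : NetState ι Y) (g : A → F) :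
    expect (π.act s) g = ∑ a ∈ M.valid s, (π.act s a).toReal • g a :=
  expect_eq_sum _ _ _ fun a ha => by rw [act_eq_zero π s ha]; simp

theorem sum_act (π : Policy M) (s : NetState ι Y) :
    ∑ a ∈ M.valid s, (π.act s a).toReal = 1 := by
  rw [← ENNReal.toReal_sum fun a _ => PMF.apply_ne_top _ _, ← tsum_eq_sum (L := .unconditional A)
    fun a ha => act_eq_zero π s ha]
  simp

theorem expect_step (π : Policy M) (s : NetState ι Y) (g : NetState ι Y → ℝ) :
    expect (step M π s) g =
      ∑ a ∈ M.valid s, (π.act s a).toReal * expect (M.trans s a) g := by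
  rw [step, expect_bind (act_finite π s) (trans_finite_of_mem π s), expect_act]
  rfl

theorem expect_trans_iter (π : Policy M) {s : NetState ι Y} {a : A} (ha : a ∈ M.valid s) (j : ℕ)
    (c : NetState ι Y → ℝ) :
    expect (M.trans s a) (fun x => expect (iter (step M π) j x) c) =
      expect (stateLawFrom M π s a (j + 1)) c := by
  rw [stateLawFrom, stateLaw_eq, expect_bind (M.trans_finite s a ha) fun x _ =>
    iter_finite (step_finite π) j x]

/-- Change of the expected cost `j` steps later when, for the current step only, the policy `π` is
replaced by `π'`. -/
noncomputable def deviation (π π' : Policy M) (j : ℕ) (s : NetState ι Y) : ℝ :=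
  expect (step M π' s) (fun x => expect (iter (step M π) j x) M.cost) -
    expect (step M π s) (fun x => expect (iter (step M π) j x) M.cost)

/-- The weights π' - π sum to zero over the actions, so the centring by η and the time-zero cost,
neither depending on the action, drop out. Deviation j corresponds to time j + 1 in the series for
Q. -/
theorem tendsto_sum_deviation (π π' : Policy M) {η : ℝ} {s : NetState ι Y} {q : A → ℝ}
    (hq : ∀ a ∈ M.valid s, IsActionValue M π η s a (q a)) :
    Tendsto (fun N : ℕ => ∑ j ∈ Finset.range N, deviation π π' j s) atTop
      (𝓝 (∑ a ∈ M.valid s, ((π'.act s a).toReal - (π.act s a).toReal) * q a)) := by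
  have hlim : Tendsto (fun N : ℕ => ∑ a ∈ M.valid s,
      ((π'.act s a).toReal - (π.act s a).toReal) *
        ∑ t ∈ Finset.range (N + 1), (expect (stateLawFrom M π s a t) M.cost - η)) atTop
      (𝓝 (∑ a ∈ M.valid s, ((π'.act s a).toReal - (π.act s a).toReal) * q a)) :=
    tendsto_finsetSum _ fun a ha => ((tendsto_add_atTop_iff_nat 1).2 (hq a ha)).const_mul _
  refine hlim.congr fun N => ?_
  have hzero : ∑ a ∈ M.valid s, ((π'.act s a).toReal - (π.act s a).toReal) = 0 := by
    rw [Finset.sum_sub_distrib, sum_act, sum_act, sub_self]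
  have hdev : ∀ j, deviation π π' j s = ∑ a ∈ M.valid s,
      ((π'.act s a).toReal - (π.act s a).toReal) *
        expect (stateLawFrom M π s a (j + 1)) M.cost := fun j => by
    rw [deviation, expect_step, expect_step, ← Finset.sum_sub_distrib]
    exact Finset.sum_congr rfl fun a ha => by rw [expect_trans_iter π ha, sub_mul]
  have hsum : ∀ a, ∑ t ∈ Finset.range (N + 1), (expect (stateLawFrom M π s a t) M.cost - η) =
      ∑ j ∈ Finset.range N, expect (stateLawFrom M π s a (j + 1)) M.cost +
        (M.cost s - (N + 1) * η) := fun a => by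
    rw [Finset.sum_range_succ']
    simp only [Finset.sum_sub_distrib, stateLawFrom, expect_pure, Finset.sum_const,
      Finset.card_range, nsmul_eq_mul]
    ring
  simp only [hdev, hsum, mul_add, Finset.sum_add_distrib, ← Finset.sum_mul, hzero, zero_mul,
    add_zero]
  rw [Finset.sum_comm]
  simp only [Finset.mul_sum]

/-- Duhamel's formula from each initial state, where supports are finite, integrated against the
initial law; `h` and `h'` justify the integration. -/
theorem expect_stateLaw_sub {π π' : Policy M} (L : Finset (NetState ι Y))
    (hL : ∀ s ∉ L, π'.act s = π.act s) (t : ℕ)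
    (h : Summable fun s => (stateLaw M π M.init t s).toReal * M.cost s)
    (h' : Summable fun s => (stateLaw M π' M.init t s).toReal * M.cost s) :
    expect (stateLaw M π' M.init t) M.cost = expect (stateLaw M π M.init t) M.cost +
      ∑ k ∈ Finset.range t, ∑ s ∈ L,
        (stateLaw M π' M.init k s).toReal * deviation π π' (t - 1 - k) s := by
  rw [stateLaw_eq] at h h'
  have e := hasSum_expect_bind _ _ _ h
  have e' := hasSum_expect_bind _ _ _ h'
  have hstep : ∀ s ∉ L, step M π' s = step M π s := fun s hs => by rw [step, hL s hs, step]
  have e3 : HasSum (fun x => ∑ k ∈ Finset.range t, ∑ s ∈ L,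
      (M.init x).toReal * (iter (step M π') k x s).toReal * deviation π π' (t - 1 - k) s)
      (∑ k ∈ Finset.range t, ∑ s ∈ L,
        (stateLaw M π' M.init k s).toReal * deviation π π' (t - 1 - k) s) := by
    refine hasSum_sum fun k _ => hasSum_sum fun s _ => HasSum.mul_right _ ?_
    rw [stateLaw_eq, bind_apply_toReal]
    exact (summable_toReal_bind _ _ _).hasSum
  rw [stateLaw_eq, stateLaw_eq π]
  refine e'.unique ?_
  convert e.add e3 using 1
  ext x
  rw [expect_iter_sub (step_finite π) (step_finite π') L hstep t M.cost x, mul_add]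
  simp only [Finset.mul_sum, mul_assoc, deviation]

/-- Performance difference formula for two policies that agree off the finite set `L`. -/
theorem averageCost_sub {π π' : Policy M} (L : Finset (NetState ι Y))
    (hL : ∀ s ∉ L, π'.act s = π.act s) {η η' : ℝ} (hη : IsAverageCost M π η)
    (hη' : IsAverageCost M π' η') {Q : NetState ι Y → A → ℝ}
    (hQ : ∀ s ∈ L, ∀ a ∈ M.valid s, IsActionValue M π η s a (Q s a))
    {d : PMF (NetState ι Y)}
    (hd : ∀ s₀ x, Tendsto (fun T => occupation (step M π') s₀ T x) atTop (𝓝 (d x))) :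
    η' - η = ∑ s ∈ L, (d s).toReal *
      ∑ a ∈ M.valid s, ((π'.act s a).toReal - (π.act s a).toReal) * Q s a := by
  have h1 : Tendsto (fun N : ℕ => ∑ s ∈ L, (∑ T ∈ Finset.range N, ∑ k ∈ Finset.range T,
      (stateLaw M π' M.init k s).toReal * deviation π π' (T - 1 - k) s) / (N : ℝ)) atTop
      (𝓝 (∑ s ∈ L, (d s).toReal *
        ∑ a ∈ M.valid s, ((π'.act s a).toReal - (π.act s a).toReal) * Q s a)) :=
    tendsto_finsetSum _ fun s hs => tendsto_cesaro_convolution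
      (m := fun k => (stateLaw M π' M.init k s).toReal) (w := fun j => deviation π π' j s) (fun k => by
        rw [abs_of_nonneg ENNReal.toReal_nonneg]
        exact ENNReal.toReal_mono ENNReal.one_ne_top (PMF.coe_le_one _ _))
      (tendsto_cesaro_stateLaw hd M.init s) (tendsto_sum_deviation π π' (hQ s hs))
  refine tendsto_nhds_unique (hη'.2.sub hη.2) (h1.congr fun N => ?_)
  rw [← sub_div, ← Finset.sum_sub_distrib, ← Finset.sum_div, Finset.sum_comm]
  congr 1
  refine Finset.sum_congr rfl fun T _ => ?_
  rw [expect_stateLaw_sub L hL T (hη.1 T) (hη'.1 T), add_sub_cancel_left, Finset.sum_comm]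

end performance

/-! ### Continuity of the stationary distribution -/

section continuity

variable {ι Y A : Type*} {M : NetworkMDP ι Y A}

theorem step_apply (π : Policy M) (s x : NetState ι Y) :
    step M π s x = ∑ a ∈ M.valid s, π.act s a * M.trans s a x := by
  rw [step, PMF.bind_apply]
  exact tsum_eq_sum fun a ha => by rw [act_eq_zero π s ha, zero_mul]

/-- Continuity of the stationary distribution under perturbations of the policy on a finite set. -/
theorem tendsto_steadyState {Θ : Type*} {l : Filter Θ} (L : Finset (NetState ι Y)) (π : Policy M)
    (π' : Θ → Policy M) (hL : ∀ j, ∀ s ∉ L, (π' j).act s = π.act s)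
    (hlim : ∀ s ∈ L, ∀ a ∈ M.valid s, Tendsto (fun j => (π' j).act s a) l (𝓝 (π.act s a)))
    (d : PMF (NetState ι Y)) (hu : ∀ d₁, IsSteadyState M π d₁ → d₁ = d)
    (d' : Θ → PMF (NetState ι Y))
    (hd' : ∀ᶠ j in l, IsSteadyState M (π' j) (d' j) ∧
      ∀ d₁, IsSteadyState M (π' j) d₁ → d₁ = d' j) (x : NetState ι Y) :
    Tendsto (fun j => d' j x) l (𝓝 (d x)) := by
  classical
  have hstep : ∀ j, ∀ s ∉ L, step M (π' j) s = step M π s := fun j s hs => by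
    rw [step, hL j s hs, step]
  obtain ⟨D, hD, hdom⟩ := exists_summable_dominating L (step M π) d hu
    (L.sigma M.valid) (fun b : (_ : NetState ι Y) × A => M.trans b.1 b.2)
  have hle : ∀ᶠ j in l, ∀ y ∉ L, d' j y ≤ D y := hd'.mono fun j hj => by
    -- The entrance laws are the transitions P(·|s,a) with s in L; their coefficients d'(s) π'(a|s)
    -- are at most one.
    refine hdom (step M (π' j)) (d' j) (fun b => d' j b.1 * (π' j).act b.1 b.2) (hstep j) hj.2 hj.1
      (fun b _ => mul_le_one' (PMF.coe_le_one _ _) (PMF.coe_le_one _ _)) fun y => ?_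
    rw [Finset.sum_sigma]
    refine Finset.sum_congr rfl fun s _ => ?_
    rw [step_apply, Finset.mul_sum]
    exact Finset.sum_congr rfl fun a _ => (mul_assoc _ _ _).symm
  refine (tendsto_iff_ultrafilter _ _ _).2 fun U hU => ?_
  obtain ⟨d₁, hd₁, hd₁lim⟩ := exists_invariant_ultralimit U (fun j y => d' j y)
    (fun j => by simp) (fun j => step M (π' j)) (step M π) (fun y z => by
      by_cases hy : y ∈ L
      · simp only [step_apply]
        exact tendsto_finsetSum _ fun a ha => ENNReal.Tendsto.mul_const
          ((hlim y hy a ha).mono_left hU) (Or.inr (PMF.apply_ne_top _ _))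
      · simp only [fun j => hstep j y hy]
        exact tendsto_const_nhds) (fun _ => 0) tendsto_const_nhds
    ((hd'.filter_mono hU).mono fun j hj y => by
      rw [← PMF.bind_apply, show (d' j).bind (step M (π' j)) = d' j from hj.1, add_zero])
    (fun r hr => by
      -- Tightness: the tail of the summable D outside a large F₀ is at most r, and L is added
      -- because D dominates only off L.
      obtain ⟨F₀, hF₀⟩ := ((ENNReal.tendsto_tsum_compl_atTop_zero hD).eventually_le_const hr).exists
      refine ⟨F₀ ∪ L, (hle.filter_mono hU).mono fun j hj => ?_⟩
      have hpt : ∀ y, d' j y ≤ (if y ∈ F₀ ∪ L then d' j y else 0) +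
          ({y | y ∉ F₀} : Set (NetState ι Y)).indicator D y := fun y => by
        by_cases hy : y ∈ F₀ ∪ L
        · rw [if_pos hy]; exact le_self_add
        · rw [if_neg hy, zero_add]
          rw [Finset.mem_union, not_or] at hy
          rw [Set.indicator_of_mem (show y ∈ {y | y ∉ F₀} from hy.1)]
          exact hj y hy.2
      calc (1 : ℝ≥0∞) = ∑' y, d' j y := (PMF.tsum_coe _).symm
        _ ≤ _ := ENNReal.tsum_le_tsum hpt
        _ = ∑ y ∈ F₀ ∪ L, d' j y + ∑' y : {y // y ∉ F₀}, D y := by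
          rw [ENNReal.tsum_add, ← tsum_subtype, tsum_eq_sum (s := F₀ ∪ L) fun y hy => if_neg hy]
          exact congrArg₂ _ (Finset.sum_congr rfl fun y hy => if_pos hy) rfl
        _ ≤ _ := by gcongr)
  rw [← hu d₁ hd₁]
  exact hd₁lim x

end continuity

/-! ### Differentiation -/

section gradient

variable {E : Type*} [NormedAddCommGroup E]

/-- Continuity of w suffices: (w - c)φ is o(1)·O(x - θ) because φ vanishes at θ. -/
theorem hasFDerivAt_mul_of_eq_zero [NormedSpace ℝ E] {w φ : E → ℝ} {φ' : E →L[ℝ] ℝ} {θ : E} {c : ℝ}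
    (hw : Tendsto w (𝓝 θ) (𝓝 c)) (hφ : HasFDerivAt φ φ' θ) (h0 : φ θ = 0) :
    HasFDerivAt (fun x => w x * φ x) (c • φ') θ := by
  have h1 : HasFDerivAt (fun x => (w x - c) * φ x) (0 : E →L[ℝ] ℝ) θ := by
    rw [hasFDerivAt_iff_isLittleO]
    have hw0 : (fun x => w x - c) =o[𝓝 θ] (fun _ => (1 : ℝ)) := by
      rw [Asymptotics.isLittleO_one_iff]
      simpa using hw.sub_const c
    have hO : φ =O[𝓝 θ] fun x => x - θ := by simpa [h0] using hφ.isBigO_sub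
    have := hw0.mul_isBigO hO.norm_right
    simp only [one_mul] at this
    simpa [h0] using this.of_norm_right
  have h2 := h1.add (hφ.const_mul c)
  rw [zero_add] at h2
  exact h2.congr_of_eventuallyEq (Eventually.of_forall fun x => by simp only [Pi.add_apply]; ring)

variable [InnerProductSpace ℝ E] [CompleteSpace E]

/-- The log-derivative trick; at a zero of the nonnegative function `f` both sides vanish. -/
theorem hasGradientAt_smul_gradient_log {f : E → ℝ} {θ : E} (hf : DifferentiableAt ℝ f θ)
    (h0 : ∀ x, 0 ≤ f x) :
    HasGradientAt f (f θ • gradient (fun x => Real.log (f x)) θ) θ := by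
  rw [hasGradientAt_iff_hasFDerivAt]
  rcases (h0 θ).eq_or_lt with h | h
  -- A zero of a nonnegative function is a minimum, so the derivative vanishes whatever value the
  -- gradient of the logarithm takes.
  · have hmin : IsLocalMin f θ := Eventually.of_forall fun x => by rw [← h]; exact h0 x
    rw [← h, zero_smul, map_zero, ← hmin.fderiv_eq_zero]
    exact hf.hasFDerivAt
  · rw [gradient, (hf.hasFDerivAt.log h.ne').fderiv]
    simp only [map_smul, LinearIsometryEquiv.apply_symm_apply,
      smul_smul, mul_inv_cancel₀ h.ne', one_smul]
    exact hf.hasFDerivAt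

end gradient

end QueueControl

open QueueControl in
theorem mainTheorem3 {ι Y A : Type*} [Fintype ι] [Fintype Y] (M : NetworkMDP ι Y A)
    (L : Finset (NetState ι Y)) (π₀ : Policy M) {p : ℕ}
    (actor : EuclideanSpace ℝ (Fin p) → Policy M) (θ : EuclideanSpace ℝ (Fin p))
    (hdiff : ∀ s ∈ L, ∀ a ∈ M.valid s,
      DifferentiableAt ℝ (fun θ' => ((actor θ').act s a).toReal) θ)
    (hstable : ∀ᶠ θ' in 𝓝 θ, IsStronglyStable M (assisted L π₀ (actor θ')))
    (hunique : ∀ᶠ θ' in 𝓝 θ, ∀ d₁ d₂ : PMF (NetState ι Y),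
      IsSteadyState M (assisted L π₀ (actor θ')) d₁ →
      IsSteadyState M (assisted L π₀ (actor θ')) d₂ → d₁ = d₂)
    (η : EuclideanSpace ℝ (Fin p) → ℝ)
    (hη : ∀ᶠ θ' in 𝓝 θ, IsAverageCost M (assisted L π₀ (actor θ')) (η θ'))
    (Q : NetState ι Y → A → ℝ)
    (hQ : ∀ s ∈ L, ∀ a ∈ M.valid s,
      IsActionValue M (assisted L π₀ (actor θ)) (η θ) s a (Q s a)) :
    ∃ d : PMF (NetState ι Y), IsSteadyState M (assisted L π₀ (actor θ)) d ∧
      HasGradientAt η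
        (expect d fun s => expect ((assisted L π₀ (actor θ)).act s) fun a =>
          ((1 - intervention L s) * Q s a) •
            gradient (fun θ' => Real.log ((actor θ').act s a).toReal) θ) θ ∧
      HasGradientAt η
        (∑ s ∈ L, (d s).toReal • ∑ a ∈ M.valid s, (((actor θ).act s a).toReal * Q s a) •
            gradient (fun θ' => Real.log ((actor θ').act s a).toReal) θ) θ := by
  classical
  set πI : EuclideanSpace ℝ (Fin p) → Policy M := fun θ' => assisted L π₀ (actor θ') with hπI
  have hon : ∀ θ', ∀ s ∈ L, (πI θ').act s = (actor θ').act s := fun θ' s hs => by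
    simp [hπI, assisted, hs]
  have hoff : ∀ θ', ∀ s ∉ L, (πI θ').act s = (πI θ).act s := fun θ' s hs => by
    simp [hπI, assisted, hs]
  have hex : ∀ᶠ θ' in 𝓝 θ, ∃ d : PMF (NetState ι Y), IsSteadyState M (πI θ') d ∧
      ∀ s₀ x, Tendsto (fun T => occupation (step M (πI θ')) s₀ T x) atTop (𝓝 (d x)) :=
    (hstable.and hunique).mono fun θ' h => exists_tendsto_occupation h.1 h.2
  have : Nonempty (PMF (NetState ι Y)) := ⟨M.init⟩
  obtain ⟨d, hd⟩ := hex.choice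
  have hdθ := hd.self_of_nhds
  have hlimd : ∀ s, Tendsto (fun θ' => (d θ' s).toReal) (𝓝 θ) (𝓝 (d θ s).toReal) := fun s => by
    refine (ENNReal.tendsto_toReal ((d θ).apply_ne_top s)).comp
      (tendsto_steadyState L (πI θ) πI hoff (fun s hs a ha => ?_) (d θ)
        (fun d₁ h => hunique.self_of_nhds d₁ (d θ) h hdθ.1) d
        ((hd.and hunique).mono fun θ' h => ⟨h.1.1, fun d₁ h₁ => h.2 d₁ _ h₁ h.1.1⟩) s)
    simp only [hon _ s hs]
    rw [← ENNReal.tendsto_toReal_iff (fun _ => PMF.apply_ne_top _ _) (PMF.apply_ne_top _ _)]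
    exact (hdiff s hs a ha).continuousAt
  have hsub : ∀ᶠ θ' in 𝓝 θ, η θ' = ∑ s ∈ L, (d θ' s).toReal * (∑ a ∈ M.valid s,
      (((actor θ').act s a).toReal - ((actor θ).act s a).toReal) * Q s a) + η θ :=
    (hd.and hη).mono fun θ' h => by
      rw [← sub_eq_iff_eq_add, averageCost_sub (π := πI θ) (π' := πI θ') L (hoff θ')
        hη.self_of_nhds h.2 hQ h.1.2]
      refine Finset.sum_congr rfl fun s hs => ?_
      rw [hon θ' s hs, hon θ s hs]
  have hgrad : HasGradientAt η
      (∑ s ∈ L, (d θ s).toReal • ∑ a ∈ M.valid s, (((actor θ).act s a).toReal * Q s a) •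
        gradient (fun θ' => Real.log ((actor θ').act s a).toReal) θ) θ := by
    rw [hasGradientAt_iff_hasFDerivAt]
    refine HasFDerivAt.congr_of_eventuallyEq ?_ hsub
    refine HasFDerivAt.add_const _ ?_
    rw [map_sum]
    refine HasFDerivAt.fun_sum fun s hs => ?_
    rw [LinearIsometryEquiv.map_smulₛₗ, conj_trivial]
    refine hasFDerivAt_mul_of_eq_zero (hlimd s) ?_ (by simp)
    rw [map_sum]
    refine HasFDerivAt.fun_sum fun a ha => ?_
    rw [mul_comm, mul_smul, LinearIsometryEquiv.map_smulₛₗ, conj_trivial]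
    have := (hasGradientAt_smul_gradient_log (hdiff s hs a ha)
      fun _ => ENNReal.toReal_nonneg).hasFDerivAt
    exact (this.sub_const _).mul_const (Q s a)
  refine ⟨d θ, hdθ.1, ?_, hgrad⟩
  convert hgrad using 1
  -- The factor 1 - I(s) vanishes off L, which reduces the outer expectation to a finite sum.
  rw [expect_eq_sum _ _ L fun s hs => by simp [expect, intervention, hs]]
  refine Finset.sum_congr rfl fun s hs => ?_
  rw [expect_act, hon θ s hs]
  simp only [intervention, hs, if_true, sub_zero, one_mul, smul_smul]
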